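/- Let $n\ge 0$ be an integer, let $\mathbb S^n=\{x\in\mathbb R^{n+1}:\|x\|=1\}$ be the Euclidean unit sphere with the distance $\|x-y\|$ inherited from $\mathbb R^{n+1}$, and let $\sigma$ be the uniform probability measure on $\mathbb S^n$ (surface measure divided by the total surface area). Put $C=\frac{1}{18\pi^3}$. Let $\eta>0$ and let $f:\mathbb S^n\to\mathbb R$ be $\eta$-Lipschitz, i.e. $|f(\phi_1)-f(\phi_2)|\le\eta\,\|\phi_1-\phi_2\|$ for all $\phi_1,\phi_2\in\mathbb S^n$. If $\phi$ is a point of $\mathbb S^n$ chosen uniformly at random, i.e. with law $\sigma$, and $\langle f\rangle=\int_{\mathbb S^n} f\,d\sigma$ denotes the average of $f$, then for every $\varepsilon>0$ $$\mathrm{Prob}\big(|f(\phi)-\langle f\rangle|\ge\varepsilon\big)\le 2\exp\Big(-\frac{2C(n+1)}{\eta^2}\,\varepsilon^2\Big).$$ -/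

import Mathlib

open MeasureTheory
open scoped NNReal

noncomputable section

/-- The unit sphere `𝕊ⁿ` of `ℝⁿ⁺¹`, with the Euclidean (chordal) distance. -/
abbrev USphere (n : ℕ) : Type :=
  Metric.sphere (0 : EuclideanSpace ℝ (Fin (n + 1))) 1

/-- The uniform probability measure on `𝕊ⁿ`: surface measure divided by the total surface area. -/
def uniformSphere (n : ℕ) : Measure (USphere n) :=
  ((volume : Measure (EuclideanSpace ℝ (Fin (n + 1)))).toSphere Set.univ)⁻¹ •
    (volume : Measure (EuclideanSpace ℝ (Fin (n + 1)))).toSphere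

instance uniformSphere.instIsProbabilityMeasure (n : ℕ) :
    IsProbabilityMeasure (uniformSphere n) where
  measure_univ := by
    have h : (volume : Measure (EuclideanSpace ℝ (Fin (n + 1)))).toSphere Set.univ ≠ 0 := by
      rw [Ne, Measure.measure_univ_eq_zero]
      exact Measure.toSphere_ne_zero _
    rw [uniformSphere, Measure.smul_apply, smul_eq_mul]
    exact ENNReal.inv_mul_cancel h (measure_ne_top _ _)

/-- The constant `C = 1 / (18 π³)`. -/
def levyConst : ℝ := 1 / (18 * Real.pi ^ 3)

end

/-! Concentration is proved for the standard Gaussian on `ℝⁿ⁺¹` and carried to the sphere by polar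
coordinates. For a `K`-Lipschitz `F` and independent Gaussians `x`, `y`, rotating `x` into `y`
writes `F y - F x` as an integral of derivatives; Jensen and rotation invariance bound `E exp (F y -
F x)` by `exp (π² K² / 8)` (`LipschitzWith.lintegral_exp_sub_stdGaussian_le`).

A mean-zero `K`-Lipschitz `g` on the sphere extends to the `4K`-Lipschitz function `r • u ↦ r * g
u`. Radius and direction of a Gaussian are independent, so Jensen in the radius replaces `r` by its
mean `m`, giving `E exp (m g) ≤ exp (2 π² K²)` (`LipschitzWith.lintegral_exp_uniformSphere_le`).
Since `m² ≥ 2(n+1)/π`, Markov's inequality applied to multiples of `g` gives the one-sided tail; `f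
- ⟨f⟩` and `⟨f⟩ - f` together give the factor 2. -/

/-! ### Gaussian concentration by rotation (Maurey-Pisier) -/

/-- Lipschitz functions are uniform limits of smooth functions with the same Lipschitz constant. -/
theorem LipschitzWith.exists_contDiff_approx {E : Type*} [NormedAddCommGroup E]
    [InnerProductSpace ℝ E] [FiniteDimensional ℝ E] [MeasurableSpace E] [BorelSpace E]
    {F : E → ℝ} {K : ℝ≥0} (hF : LipschitzWith K F) {δ : ℝ} (hδ : 0 < δ) :
    ∃ G : E → ℝ, ContDiff ℝ 1 G ∧ LipschitzWith K G ∧ ∀ x, |G x - F x| ≤ K * δ := by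
  let φ : ContDiffBump (0 : E) := ⟨δ / 2, δ, by positivity, by linarith⟩
  let G : E → ℝ := convolution (φ.normed volume) F (ContinuousLinearMap.lsmul ℝ ℝ) volume
  have hG : ∀ x, G x = ∫ t, φ.normed volume t * F (x - t) := fun x => by
    simp [G, convolution]
  have hint : ∀ x, Integrable (fun t => φ.normed volume t * F (x - t)) := fun x =>
    (φ.continuous_normed.mul (hF.continuous.comp (by fun_prop))).integrable_of_hasCompactSupport
      (φ.hasCompactSupport_normed.mul_right)
  refine ⟨G, ?_, ?_, fun x => ?_⟩
  · have h1 : HasCompactSupport (φ.normed (volume : Measure E)) := φ.hasCompactSupport_normed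
    have h2 : ContDiff ℝ (1 : ℕ∞) (φ.normed (volume : Measure E)) := φ.contDiff_normed
    exact h1.contDiff_convolution_left (ContinuousLinearMap.lsmul ℝ ℝ) h2
      (hF.continuous.locallyIntegrable (μ := volume))
  · refine LipschitzWith.of_dist_le_mul fun x y => ?_
    rw [dist_eq_norm, hG, hG, ← integral_sub (hint x) (hint y)]
    calc ‖∫ t, φ.normed volume t * F (x - t) - φ.normed volume t * F (y - t)‖
        ≤ ∫ t, φ.normed volume t * (K * dist x y) := by
          refine norm_integral_le_of_norm_le (φ.integrable_normed.mul_const _)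
            (.of_forall fun t => ?_)
          rw [← mul_sub, norm_mul, Real.norm_of_nonneg (φ.nonneg_normed t)]
          refine mul_le_mul_of_nonneg_left ?_ (φ.nonneg_normed t)
          simpa [Real.dist_eq] using hF.dist_le_mul (x - t) (y - t)
      _ = K * dist x y := by rw [integral_mul_const, φ.integral_normed, one_mul]
  · rw [← Real.dist_eq]
    refine φ.dist_normed_convolution_le hF.continuous.aestronglyMeasurable fun y hy => ?_
    refine (hF.dist_le_mul y x).trans ?_
    gcongr
    exact (Metric.mem_ball.1 hy).le

open ProbabilityTheory in
theorem lintegral_exp_strongDual_stdGaussian {E : Type*} [NormedAddCommGroup E]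
    [InnerProductSpace ℝ E] [FiniteDimensional ℝ E] [MeasurableSpace E] [BorelSpace E]
    (ℓ : StrongDual ℝ E) (t : ℝ) :
    ∫⁻ y, ENNReal.ofReal (Real.exp (t * ℓ y)) ∂(stdGaussian E) =
      ENNReal.ofReal (Real.exp (‖ℓ‖ ^ 2 * t ^ 2 / 2)) := by
  have hmap := IsGaussian.map_eq_gaussianReal (μ := stdGaussian E) ℓ
  rw [integral_strongDual_stdGaussian, variance_dual_stdGaussian] at hmap
  have h := mgf_gaussianReal hmap t
  have hi : Integrable (fun y => Real.exp (t * ℓ y)) (stdGaussian E) := by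
    have := integrable_exp_mul_gaussianReal (μ := 0) (v := (‖ℓ‖ ^ 2).toNNReal) t
    rw [← hmap] at this
    exact this.comp_measurable (by fun_prop)
  rw [← ofReal_integral_eq_lintegral_ofReal hi (.of_forall fun _ => (Real.exp_pos _).le)]
  rw [mgf] at h
  rw [h]
  simp [Real.coe_toNNReal _ (sq_nonneg ‖ℓ‖)]

/-- Jensen for the uniform law on `(0, a]`: the integral of `h` is the average of `a * h`. -/
theorem exp_intervalIntegral_le_lintegral {h : ℝ → ℝ} (hh : Continuous h) {a : ℝ} (ha : 0 < a) :
    ENNReal.ofReal (Real.exp (∫ s in (0 : ℝ)..a, h s)) ≤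
      ENNReal.ofReal a⁻¹ * ∫⁻ s in Set.Ioc 0 a, ENNReal.ofReal (Real.exp (a * h s)) := by
  have hcont : Continuous fun s => Real.exp (a * h s) := by fun_prop
  have hi : IntegrableOn (fun s => Real.exp (a * h s)) (Set.Ioc 0 a) :=
    (hcont.intervalIntegrable 0 a).1
  have hJ := convexOn_exp.map_set_average_le (μ := volume) (t := Set.Ioc 0 a)
    (f := fun s => a * h s) Real.continuous_exp.continuousOn isClosed_univ (by simp [ha])
    (by simp) (by simp) ((Continuous.intervalIntegrable (by fun_prop) 0 a).1) hi
  rw [setAverage_eq, setAverage_eq] at hJ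
  simp only [measureReal_def, Real.volume_Ioc, sub_zero, ENNReal.toReal_ofReal ha.le,
    smul_eq_mul, integral_const_mul, inv_mul_cancel_left₀ ha.ne'] at hJ
  rw [intervalIntegral.integral_of_le ha.le,
    ← ofReal_integral_eq_lintegral_ofReal hi (.of_forall fun _ => (Real.exp_pos _).le),
    ← ENNReal.ofReal_mul (by positivity)]
  exact ENNReal.ofReal_le_ofReal hJ

theorem Continuous.rotation {X E : Type*} [TopologicalSpace X] [NormedAddCommGroup E]
    [NormedSpace ℝ E] {θ : X → ℝ} {p : X → E × E} (hθ : Continuous θ) (hp : Continuous p) :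
    Continuous fun x => ContinuousLinearMap.rotation (θ x) (p x) := by
  simp only [ContinuousLinearMap.rotation_apply]
  fun_prop

/-- The path `cos θ • x + sin θ • y` runs from `x` to `y`, and its velocity is the second component
of the rotated pair. The integrand is thus one fixed function of a pair whose Gaussian law does not
depend on `θ`. -/
theorem ContDiff.sub_eq_integral_rotation {E : Type*} [NormedAddCommGroup E]
    [NormedSpace ℝ E] {F : E → ℝ} (hd : ContDiff ℝ 1 F) (p : E × E) :
    F p.2 - F p.1 = ∫ θ in (0 : ℝ)..Real.pi / 2,
      fderiv ℝ F (ContinuousLinearMap.rotation θ p).1 (ContinuousLinearMap.rotation θ p).2 := by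
  have hderiv : ∀ θ : ℝ, HasDerivAt (fun θ => F (Real.cos θ • p.1 + Real.sin θ • p.2))
      (fderiv ℝ F (ContinuousLinearMap.rotation θ p).1
        (ContinuousLinearMap.rotation θ p).2) θ := by
    intro θ
    have h1 : HasDerivAt (fun θ => Real.cos θ • p.1 + Real.sin θ • p.2)
        (-Real.sin θ • p.1 + Real.cos θ • p.2) θ :=
      ((Real.hasDerivAt_cos θ).smul_const p.1).add ((Real.hasDerivAt_sin θ).smul_const p.2)
    exact ((hd.differentiable (by norm_num)
      (Real.cos θ • p.1 + Real.sin θ • p.2)).hasFDerivAt).comp_hasDerivAt θ h1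
  have hrot : Continuous fun θ : ℝ => ContinuousLinearMap.rotation θ p :=
    continuous_id.rotation continuous_const
  have hcont : Continuous fun θ : ℝ => fderiv ℝ F (ContinuousLinearMap.rotation θ p).1
      (ContinuousLinearMap.rotation θ p).2 :=
    ((hd.continuous_fderiv one_ne_zero).comp (continuous_fst.comp hrot)).clm_apply
      (continuous_snd.comp hrot)
  rw [intervalIntegral.integral_eq_sub_of_hasDerivAt (fun θ _ => hderiv θ)
    (hcont.intervalIntegrable _ _)]
  simp

open ProbabilityTheory in
-- For fixed `x` the derivative is a linear form in the independent Gaussian `y`, hence centred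
-- Gaussian of variance at most `K²`; the exponent is `(π/2)² K² / 2`.
theorem lintegral_exp_fderiv_stdGaussian_le {E : Type*} [NormedAddCommGroup E]
    [InnerProductSpace ℝ E] [FiniteDimensional ℝ E] [MeasurableSpace E] [BorelSpace E]
    {F : E → ℝ} {K : ℝ≥0} (hF : LipschitzWith K F) (hd : ContDiff ℝ 1 F) :
    ∫⁻ p, ENNReal.ofReal (Real.exp (Real.pi / 2 * fderiv ℝ F p.1 p.2))
        ∂((stdGaussian E).prod (stdGaussian E)) ≤
      ENNReal.ofReal (Real.exp (Real.pi ^ 2 / 8 * K ^ 2)) := by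
  have hH : Continuous fun p : E × E => fderiv ℝ F p.1 p.2 :=
    ((hd.continuous_fderiv one_ne_zero).comp continuous_fst).clm_apply continuous_snd
  have hmeas : Measurable fun p : E × E =>
      ENNReal.ofReal (Real.exp (Real.pi / 2 * fderiv ℝ F p.1 p.2)) :=
    (Real.continuous_exp.comp (continuous_const.mul hH)).measurable.ennreal_ofReal
  rw [lintegral_prod _ hmeas.aemeasurable]
  calc ∫⁻ x, ∫⁻ y, ENNReal.ofReal (Real.exp (Real.pi / 2 * fderiv ℝ F x y)) ∂(stdGaussian E)
        ∂(stdGaussian E)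
      ≤ ∫⁻ _, ENNReal.ofReal (Real.exp (Real.pi ^ 2 / 8 * K ^ 2)) ∂(stdGaussian E) := by
        refine lintegral_mono fun x => ?_
        rw [lintegral_exp_strongDual_stdGaussian]
        refine ENNReal.ofReal_le_ofReal (Real.exp_le_exp.2 ?_)
        have := norm_fderiv_le_of_lipschitz ℝ hF (x₀ := x)
        have := pow_le_pow_left₀ (norm_nonneg _) this 2
        nlinarith [sq_nonneg Real.pi]
    _ = _ := by simp

open ProbabilityTheory in
/-- The Maurey-Pisier estimate for continuously differentiable functions. -/
theorem lintegral_exp_sub_stdGaussian_le_of_contDiff {E : Type*} [NormedAddCommGroup E]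
    [InnerProductSpace ℝ E] [FiniteDimensional ℝ E] [MeasurableSpace E] [BorelSpace E]
    {F : E → ℝ} {K : ℝ≥0} (hF : LipschitzWith K F) (hd : ContDiff ℝ 1 F) :
    ∫⁻ p, ENNReal.ofReal (Real.exp (F p.2 - F p.1)) ∂((stdGaussian E).prod (stdGaussian E)) ≤
      ENNReal.ofReal (Real.exp (Real.pi ^ 2 / 8 * K ^ 2)) := by
  have hpi : 0 < Real.pi / 2 := by positivity
  have hbound := lintegral_exp_fderiv_stdGaussian_le hF hd
  have hpath := hd.sub_eq_integral_rotation
  have hH : Continuous fun p : E × E => fderiv ℝ F p.1 p.2 :=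
    ((hd.continuous_fderiv one_ne_zero).comp continuous_fst).clm_apply continuous_snd
  generalize hHdef : (fun p : E × E => fderiv ℝ F p.1 p.2) = H at hH
  replace hHdef : ∀ p : E × E, fderiv ℝ F p.1 p.2 = H p := fun p => congrFun hHdef p
  simp only [hHdef] at hbound hpath
  have hmeas : Measurable fun p : E × E => ENNReal.ofReal (Real.exp (Real.pi / 2 * H p)) :=
    (Real.continuous_exp.comp (continuous_const.mul hH)).measurable.ennreal_ofReal
  have hmeas' : Measurable fun q : (E × E) × ℝ => ENNReal.ofReal
      (Real.exp (Real.pi / 2 * H (ContinuousLinearMap.rotation q.2 q.1))) :=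
    hmeas.comp (continuous_snd.rotation continuous_fst).measurable
  have hrot : ∀ p : E × E, Continuous fun θ => H (ContinuousLinearMap.rotation θ p) := fun p =>
    hH.comp (continuous_id.rotation continuous_const)
  have hinner : ∀ θ : ℝ, ∫⁻ p, ENNReal.ofReal
      (Real.exp (Real.pi / 2 * H (ContinuousLinearMap.rotation θ p)))
        ∂((stdGaussian E).prod (stdGaussian E)) ≤
      ENNReal.ofReal (Real.exp (Real.pi ^ 2 / 8 * K ^ 2)) := by
    intro θ
    -- Rotations preserve the law of a pair of independent standard Gaussians, so the bound at `θ =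
    -- 0` holds for every `θ`.
    rw [← lintegral_map (f := fun p => ENNReal.ofReal (Real.exp (Real.pi / 2 * H p))) hmeas
      (ContinuousLinearMap.rotation θ).continuous.measurable,
      IsGaussian.map_rotation_eq_self integral_id_stdGaussian]
    exact hbound
  calc ∫⁻ p, ENNReal.ofReal (Real.exp (F p.2 - F p.1)) ∂((stdGaussian E).prod (stdGaussian E))
      ≤ ∫⁻ p, ENNReal.ofReal (Real.pi / 2)⁻¹ * (∫⁻ θ in Set.Ioc 0 (Real.pi / 2),
          ENNReal.ofReal (Real.exp (Real.pi / 2 * H (ContinuousLinearMap.rotation θ p))))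
          ∂((stdGaussian E).prod (stdGaussian E)) := by
        refine lintegral_mono fun p => ?_
        rw [hpath]
        exact exp_intervalIntegral_le_lintegral (hrot p) hpi
    _ = ENNReal.ofReal (Real.pi / 2)⁻¹ * ∫⁻ θ in Set.Ioc 0 (Real.pi / 2), ∫⁻ p, ENNReal.ofReal
          (Real.exp (Real.pi / 2 * H (ContinuousLinearMap.rotation θ p)))
          ∂((stdGaussian E).prod (stdGaussian E)) := by
        rw [lintegral_const_mul' _ _ ENNReal.ofReal_ne_top,
          lintegral_lintegral_swap hmeas'.aemeasurable]
    _ ≤ ENNReal.ofReal (Real.pi / 2)⁻¹ * ∫⁻ _ in Set.Ioc 0 (Real.pi / 2),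
          ENNReal.ofReal (Real.exp (Real.pi ^ 2 / 8 * K ^ 2)) := by
        gcongr with θ
        exact hinner θ
    _ = ENNReal.ofReal (Real.exp (Real.pi ^ 2 / 8 * K ^ 2)) := by
        rw [setLIntegral_const, Real.volume_Ioc, sub_zero, mul_comm, mul_assoc,
          ← ENNReal.ofReal_mul hpi.le, mul_inv_cancel₀ hpi.ne', ENNReal.ofReal_one, mul_one]

open ProbabilityTheory in
/-- The Maurey-Pisier estimate for Lipschitz functions. -/
theorem LipschitzWith.lintegral_exp_sub_stdGaussian_le {E : Type*} [NormedAddCommGroup E]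
    [InnerProductSpace ℝ E] [FiniteDimensional ℝ E] [MeasurableSpace E] [BorelSpace E]
    {F : E → ℝ} {K : ℝ≥0} (hF : LipschitzWith K F) :
    ∫⁻ p, ENNReal.ofReal (Real.exp (F p.2 - F p.1)) ∂((stdGaussian E).prod (stdGaussian E)) ≤
      ENNReal.ofReal (Real.exp (Real.pi ^ 2 / 8 * K ^ 2)) := by
  -- Smoothing moves each of the two values of `F` by at most `K * δ`; then `δ → 0`.
  have key : ∀ δ : ℝ, 0 < δ →
      ∫⁻ p, ENNReal.ofReal (Real.exp (F p.2 - F p.1)) ∂((stdGaussian E).prod (stdGaussian E)) ≤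
        ENNReal.ofReal (Real.exp (2 * (K * δ) + Real.pi ^ 2 / 8 * K ^ 2)) := by
    intro δ hδ
    obtain ⟨G, hGd, hGL, hGF⟩ := hF.exists_contDiff_approx hδ
    calc ∫⁻ p, ENNReal.ofReal (Real.exp (F p.2 - F p.1)) ∂((stdGaussian E).prod (stdGaussian E))
        ≤ ∫⁻ p, ENNReal.ofReal (Real.exp (2 * (K * δ))) *
            ENNReal.ofReal (Real.exp (G p.2 - G p.1))
            ∂((stdGaussian E).prod (stdGaussian E)) := by
          refine lintegral_mono fun p => ?_
          rw [← ENNReal.ofReal_mul (Real.exp_pos _).le, ← Real.exp_add]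
          refine ENNReal.ofReal_le_ofReal (Real.exp_le_exp.2 ?_)
          have h1 := abs_le.1 (hGF p.1)
          have h2 := abs_le.1 (hGF p.2)
          linarith [h1.1, h1.2, h2.1, h2.2]
      _ = ENNReal.ofReal (Real.exp (2 * (K * δ))) *
            ∫⁻ p, ENNReal.ofReal (Real.exp (G p.2 - G p.1))
            ∂((stdGaussian E).prod (stdGaussian E)) :=
          lintegral_const_mul' _ _ ENNReal.ofReal_ne_top
      _ ≤ _ := by
          rw [Real.exp_add, ENNReal.ofReal_mul (Real.exp_pos _).le]
          gcongr
          exact lintegral_exp_sub_stdGaussian_le_of_contDiff hGL hGd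
  have hlim : Filter.Tendsto
      (fun δ : ℝ => ENNReal.ofReal (Real.exp (2 * (K * δ) + Real.pi ^ 2 / 8 * K ^ 2)))
      (nhdsWithin 0 (Set.Ioi 0)) (nhds (ENNReal.ofReal (Real.exp (Real.pi ^ 2 / 8 * K ^ 2)))) := by
    have : Continuous
        fun δ : ℝ => ENNReal.ofReal (Real.exp (2 * (K * δ) + Real.pi ^ 2 / 8 * K ^ 2)) :=
      ENNReal.continuous_ofReal.comp (by fun_prop)
    have h := this.tendsto 0
    simp only [mul_zero, zero_add] at h
    exact h.mono_left nhdsWithin_le_nhds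
  exact ge_of_tendsto hlim (eventually_mem_nhdsWithin.mono fun δ hδ => key δ hδ)

/-! ### Density, polar decomposition and mean norm of the Gaussian -/

open ProbabilityTheory in
-- Both measures are finite and have the same characteristic function.
theorem stdGaussian_eq_withDensity {E : Type*} [NormedAddCommGroup E]
    [InnerProductSpace ℝ E] [FiniteDimensional ℝ E] [MeasurableSpace E] [BorelSpace E] :
    stdGaussian E = volume.withDensity fun x => ENNReal.ofReal
      (((2 * Real.pi) ^ (Module.finrank ℝ E / 2 : ℝ))⁻¹ * Real.exp (-(‖x‖ ^ 2 / 2))) := by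
  set c : ℝ := (2 * Real.pi) ^ (Module.finrank ℝ E / 2 : ℝ) with hc
  have hc0 : 0 < c := by positivity
  have hint : Integrable fun x : E => c⁻¹ * Real.exp (-(‖x‖ ^ 2 / 2)) := by
    have h := (GaussianFourier.integrable_cexp_neg_mul_sq_norm_add (V := E) (b := 1 / 2)
      (by norm_num) 0 0).norm
    refine (h.congr (.of_forall fun x => ?_)).const_mul _
    simp only [Complex.norm_exp]
    congr 1
    norm_num [← Complex.ofReal_pow]
    ring
  have : IsFiniteMeasure (volume.withDensity fun x : E => ENNReal.ofReal
      (c⁻¹ * Real.exp (-(‖x‖ ^ 2 / 2)))) := isFiniteMeasure_withDensity_ofReal hint.2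
  refine Measure.ext_of_charFun (funext fun t => ?_)
  rw [charFun_stdGaussian, charFun_apply, integral_withDensity_eq_integral_toReal_smul
    (by fun_prop) (.of_forall fun _ => ENNReal.ofReal_lt_top)]
  have h := GaussianFourier.integral_cexp_neg_mul_sq_norm_add (V := E) (b := 1 / 2)
    (by norm_num) Complex.I t
  have hcc : ((Real.pi : ℂ) / (1 / 2)) ^ (Module.finrank ℝ E / 2 : ℂ) = (c : ℂ) := by
    rw [hc, Complex.ofReal_cpow (by positivity)]
    push_cast
    congr 1
    ring
  rw [hcc] at h
  calc Complex.exp (-(‖t‖ : ℂ) ^ 2 / 2)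
      = (c : ℂ)⁻¹ * (c * Complex.exp (Complex.I ^ 2 * ‖t‖ ^ 2 / (4 * (1 / 2)))) := by
        rw [inv_mul_cancel_left₀ (by exact_mod_cast hc0.ne'), Complex.I_sq]
        congr 1
        ring
    _ = _ := by
        rw [← h, ← integral_const_mul]
        refine integral_congr_ae (.of_forall fun x => ?_)
        simp only
        rw [ENNReal.toReal_ofReal (by positivity), Complex.real_smul, Complex.exp_add]
        push_cast
        rw [real_inner_comm]
        ring_nf

open ProbabilityTheory in
/-- Polar decomposition of the standard Gaussian measure: the radius is independent of the
uniformly distributed direction. -/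
theorem exists_stdGaussian_eq_map_uniformSphere_prod (n : ℕ) :
    ∃ ρ : Measure (Set.Ioi (0 : ℝ)), IsProbabilityMeasure ρ ∧
      stdGaussian (EuclideanSpace ℝ (Fin (n + 1))) =
        ((uniformSphere n).prod ρ).map
          fun p => (p.2 : ℝ) • (p.1 : EuclideanSpace ℝ (Fin (n + 1))) := by
  set E := EuclideanSpace ℝ (Fin (n + 1))
  set T := (volume : Measure E).toSphere Set.univ with hT
  have hT0 : T ≠ 0 := by
    rw [hT, Ne, Measure.measure_univ_eq_zero]
    exact Measure.toSphere_ne_zero _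
  have hTtop : T ≠ ⊤ := measure_ne_top _ _
  let w : ℝ → ENNReal := fun r => ENNReal.ofReal
    (((2 * Real.pi) ^ (Module.finrank ℝ E / 2 : ℝ))⁻¹ * Real.exp (-(r ^ 2 / 2)))
  have hw : Measurable w := by fun_prop
  have hw' : Measurable fun r : Set.Ioi (0 : ℝ) => w r := hw.comp measurable_subtype_coe
  let κ : Measure (Set.Ioi (0 : ℝ)) := (Measure.volumeIoiPow n).withDensity fun r => w r
  have : SigmaFinite κ := SigmaFinite.withDensity_of_ne_top
    (.of_forall fun _ => ENNReal.ofReal_ne_top)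
  -- The total area `T`, divided out of the sphere factor, is put back on the radial factor.
  have hprod : (uniformSphere n).prod (T • κ) =
      ((volume : Measure E).toSphere.prod (Measure.volumeIoiPow n)).withDensity
        fun p => w p.2 := by
    rw [uniformSphere, Measure.prod_smul_left, Measure.prod_smul_right, smul_smul,
      ENNReal.inv_mul_cancel hT0 hTtop, one_smul]
    exact prod_withDensity_right hw'
  have hmeas : Measurable fun p : USphere n × Set.Ioi (0 : ℝ) => (p.2 : ℝ) • (p.1 : E) := by
    fun_prop
  have heq : stdGaussian E =
      ((uniformSphere n).prod (T • κ)).map fun p => (p.2 : ℝ) • (p.1 : E) := by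
    refine Measure.ext_of_lintegral _ fun f hf => ?_
    have hdim : Module.finrank ℝ E - 1 = n := by simp [E]
    have hmp := (volume : Measure E).measurePreserving_homeomorphUnitSphereProd
    rw [hdim] at hmp
    have hwn : Measurable fun x : E => ENNReal.ofReal
        (((2 * Real.pi) ^ (Module.finrank ℝ E / 2 : ℝ))⁻¹ * Real.exp (-(‖x‖ ^ 2 / 2))) :=
      hw.comp measurable_norm
    have hwp : Measurable fun p : USphere n × Set.Ioi (0 : ℝ) => w p.2 := hw'.comp measurable_snd
    have hfp : Measurable fun p : USphere n × Set.Ioi (0 : ℝ) => f ((p.2 : ℝ) • (p.1 : E)) :=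
      hf.comp hmeas
    rw [lintegral_map hf hmeas, hprod, stdGaussian_eq_withDensity,
      lintegral_withDensity_eq_lintegral_mul _ hwn hf,
      lintegral_withDensity_eq_lintegral_mul _ hwp hfp,
      ← hmp.lintegral_comp_emb (Homeomorph.measurableEmbedding _),
      ← setLIntegral_univ, ← setLIntegral_congr (ae_eq_univ.2 (by simp) :
        (({0}ᶜ : Set E)) =ᵐ[volume] Set.univ),
      ← lintegral_subtype_comap (measurableSet_singleton _).compl]
    refine lintegral_congr fun x => ?_
    have hx : ‖(x : E)‖ ≠ 0 := norm_ne_zero_iff.2 x.2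
    simp [w, smul_smul, hx]
  refine ⟨T • κ, ⟨?_⟩, heq⟩
  -- The radial mass is 1 because the other two measures are probabilities; no radial integral is
  -- computed.
  have h1 := congrArg (fun μ : Measure E => μ Set.univ) heq
  simp only [measure_univ] at h1
  rw [Measure.map_apply hmeas .univ, Set.preimage_univ, ← Set.univ_prod_univ,
    Measure.prod_prod, measure_univ, one_mul] at h1
  exact h1.symm

open ProbabilityTheory in
theorem integral_abs_gaussianReal : ∫ x, |x| ∂(gaussianReal 0 1) = √(2 / Real.pi) := by
  rw [integral_gaussianReal_eq_integral_smul one_ne_zero]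
  have h1 : ∀ x : ℝ, gaussianPDFReal 0 1 x • |x| =
      (fun t : ℝ => (√(2 * Real.pi))⁻¹ * (t ^ (1 : ℝ) * Real.exp (-(1 / 2) * t ^ (2 : ℝ)))) |x| := by
    intro x
    simp [gaussianPDFReal]
    ring_nf
  rw [integral_congr_ae (.of_forall h1), integral_comp_abs
    (f := fun t : ℝ => (√(2 * Real.pi))⁻¹ * (t ^ (1 : ℝ) * Real.exp (-(1 / 2) * t ^ (2 : ℝ)))),
    integral_const_mul,
    integral_rpow_mul_exp_neg_mul_rpow (by norm_num) (by norm_num) (by norm_num)]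
  norm_num [Real.rpow_neg_one]
  field_simp
  rw [Real.sq_sqrt (by norm_num)]

open ProbabilityTheory in
-- Cauchy-Schwarz gives `∑ |xᵢ| ≤ √(n+1) ‖x‖`, and each coordinate is a standard normal variable.
theorem sqrt_le_integral_norm_stdGaussian (n : ℕ) :
    √(n + 1) * √(2 / Real.pi) ≤
      ∫ x, ‖x‖ ∂(stdGaussian (EuclideanSpace ℝ (Fin (n + 1)))) := by
  let E := EuclideanSpace ℝ (Fin (n + 1))
  have hmap : ∀ i : Fin (n + 1), (stdGaussian E).map (fun x : EuclideanSpace ℝ (Fin (n + 1)) => x i) = gaussianReal 0 1 := by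
    intro i
    have h := IsGaussian.map_eq_gaussianReal (μ := stdGaussian E) (EuclideanSpace.proj i)
    rw [integral_strongDual_stdGaussian, variance_dual_stdGaussian] at h
    have hn : ‖(EuclideanSpace.proj i : StrongDual ℝ E)‖ = 1 := by
      have : (EuclideanSpace.proj i : StrongDual ℝ E) =
          innerSL ℝ (EuclideanSpace.single i (1 : ℝ)) := by
        ext x; simp [PiLp.inner_apply]
      rw [this, innerSL_apply_norm]
      simp
    rw [hn, one_pow, Real.toNNReal_one] at h
    exact h
  have hi : ∀ i : Fin (n + 1), Integrable (fun x : EuclideanSpace ℝ (Fin (n + 1)) => |x i|) (stdGaussian E) := fun i =>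
    ((EuclideanSpace.proj i : StrongDual ℝ E).integrable_comp IsGaussian.integrable_id).abs
  have hval : ∀ i : Fin (n + 1), ∫ x : EuclideanSpace ℝ (Fin (n + 1)), |x i| ∂(stdGaussian E) = √(2 / Real.pi) := by
    intro i
    rw [← integral_abs_gaussianReal, ← hmap i, integral_map (by fun_prop) (by fun_prop)]
  have hs : 0 < √((n : ℝ) + 1) := by positivity
  have hle : ∫ x : EuclideanSpace ℝ (Fin (n + 1)), ∑ i, |x i| ∂(stdGaussian E) ≤ ∫ x : E, √(n + 1) * ‖x‖ ∂(stdGaussian E) := by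
    refine integral_mono (integrable_finsetSum _ fun i _ => hi i)
      (IsGaussian.integrable_id.norm.const_mul _) fun x => ?_
    simp only
    rw [EuclideanSpace.norm_eq, ← Real.sqrt_mul (by positivity)]
    refine Real.le_sqrt_of_sq_le ?_
    simpa using sq_sum_le_card_mul_sum_sq (s := Finset.univ) (f := fun i => |x i|)
  rw [integral_finsetSum _ fun i _ => hi i, integral_const_mul] at hle
  simp only [hval, Finset.sum_const, Finset.card_univ, Fintype.card_fin, nsmul_eq_mul] at hle
  push_cast at hle
  rw [← Real.mul_self_sqrt (by positivity : (0 : ℝ) ≤ n + 1), mul_assoc] at hle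
  exact le_of_mul_le_mul_left (by simpa [Real.sqrt_mul_self hs.le] using hle) hs

/-! ### Jensen's inequality for the exponential -/

/-- Integrate `h + 1 ≤ exp h`; if `exp h` is not integrable, the right side is `⊤`. -/
theorem one_le_lintegral_exp {Ω : Type*} [MeasurableSpace Ω] {μ : Measure Ω}
    [IsProbabilityMeasure μ] {h : Ω → ℝ} (hi : Integrable h μ) (h0 : 0 ≤ ∫ x, h x ∂μ) :
    1 ≤ ∫⁻ x, ENNReal.ofReal (Real.exp (h x)) ∂μ := by
  by_cases hfin : Integrable (fun x => Real.exp (h x)) μ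
  · rw [← ofReal_integral_eq_lintegral_ofReal hfin (.of_forall fun _ => (Real.exp_pos _).le),
      ← ENNReal.ofReal_one]
    refine ENNReal.ofReal_le_ofReal ?_
    calc (1 : ℝ) ≤ ∫ x, (h x + 1) ∂μ := by
          rw [integral_add hi (integrable_const _)]
          simpa using h0
      _ ≤ _ := integral_mono (hi.add (integrable_const _)) hfin fun x => Real.add_one_le_exp _
  · have : ∫⁻ x, ENNReal.ofReal (Real.exp (h x)) ∂μ = ⊤ := by
      by_contra hne
      refine hfin ⟨Real.continuous_exp.comp_aestronglyMeasurable hi.aestronglyMeasurable, ?_⟩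
      rw [hasFiniteIntegral_iff_ofReal (.of_forall fun _ => (Real.exp_pos _).le)]
      exact lt_top_iff_ne_top.2 hne
    simp [this]

/-- Jensen's inequality for the exponential, without integrability of the exponential. -/
theorem ofReal_exp_integral_le_lintegral {Ω : Type*} [MeasurableSpace Ω] {μ : Measure Ω}
    [IsProbabilityMeasure μ] {h : Ω → ℝ} (hi : Integrable h μ) :
    ENNReal.ofReal (Real.exp (∫ x, h x ∂μ)) ≤ ∫⁻ x, ENNReal.ofReal (Real.exp (h x)) ∂μ := by
  set m := ∫ x, h x ∂μ with hm
  have h1 : 1 ≤ ∫⁻ x, ENNReal.ofReal (Real.exp (h x - m)) ∂μ := by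
    refine one_le_lintegral_exp (hi.sub (integrable_const _)) ?_
    rw [integral_sub hi (integrable_const _)]
    simp [hm]
  calc ENNReal.ofReal (Real.exp m)
      ≤ ENNReal.ofReal (Real.exp m) * ∫⁻ x, ENNReal.ofReal (Real.exp (h x - m)) ∂μ :=
        le_mul_of_one_le_right' h1
    _ = _ := by
        rw [← lintegral_const_mul' _ _ ENNReal.ofReal_ne_top]
        refine lintegral_congr fun x => ?_
        rw [← ENNReal.ofReal_mul (Real.exp_pos _).le, ← Real.exp_add, add_sub_cancel]

/-! ### Transfer from Gaussian space to the sphere -/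

/-- With mean zero, `g u` is the average of `g u - g v` over `v`, and the sphere has diameter at
most 2. -/
theorem LipschitzWith.abs_le_of_integral_uniformSphere_eq_zero {n : ℕ} {g : USphere n → ℝ}
    {K : ℝ≥0} (hg : LipschitzWith K g) (h0 : ∫ u, g u ∂(uniformSphere n) = 0) (u : USphere n) :
    |g u| ≤ 2 * K := by
  have hi : Integrable g (uniformSphere n) :=
    hg.continuous.integrable_of_hasCompactSupport (.of_compactSpace _)
  have h1 : g u = ∫ v, (g u - g v) ∂(uniformSphere n) := by
    rw [integral_sub (integrable_const _) hi, h0]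
    simp
  rw [h1, ← Real.norm_eq_abs]
  refine (norm_integral_le_of_norm_le_const (C := 2 * K) (.of_forall fun v => ?_)).trans (by simp)
  rw [← dist_eq_norm]
  refine (hg.dist_le_mul u v).trans ?_
  have h2 : dist u v ≤ 2 := by
    rw [Subtype.dist_eq, dist_eq_norm]
    refine (_root_.norm_sub_le _ _).trans ?_
    rw [norm_eq_of_mem_sphere, norm_eq_of_mem_sphere]
    norm_num
  rw [mul_comm]
  gcongr

/-- A bounded Lipschitz function on the unit sphere has a Lipschitz extension that is positively
homogeneous of degree one. -/
theorem LipschitzWith.exists_homogeneous_extension {n : ℕ} {g : USphere n → ℝ} {K : ℝ≥0}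
    (hg : LipschitzWith K g) (hb : ∀ u, |g u| ≤ 2 * K) :
    ∃ F : EuclideanSpace ℝ (Fin (n + 1)) → ℝ, LipschitzWith (4 * K) F ∧
      ∀ (u : USphere n) (r : ℝ), 0 < r →
        F (r • (u : EuclideanSpace ℝ (Fin (n + 1)))) = r * g u := by
  set E := EuclideanSpace ℝ (Fin (n + 1))
  have hdir : ∀ x : E, x ≠ 0 → ∃ u : USphere n, x = ‖x‖ • (u : E) := fun x hx => by
    have hx' : ‖x‖ ≠ 0 := norm_ne_zero_iff.2 hx
    exact ⟨⟨‖x‖⁻¹ • x, by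
      rw [mem_sphere_zero_iff_norm, norm_smul, norm_inv, norm_norm, inv_mul_cancel₀ hx']⟩, by simp [smul_smul, hx']⟩
  have : Nonempty (USphere n) := (NormedSpace.sphere_nonempty.2 zero_le_one).to_subtype
  choose! d hd using hdir
  have hF : ∀ x : E, ‖x‖ * |g (d x)| ≤ 4 * K * ‖x‖ := fun x => by
    nlinarith [mul_le_mul_of_nonneg_left (hb (d x)) (norm_nonneg x),
      mul_nonneg (norm_nonneg x) K.coe_nonneg]
  refine ⟨fun x => ‖x‖ * g (d x), LipschitzWith.of_dist_le_mul fun x y => ?_, fun u r hr => ?_⟩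
  · rw [Real.dist_eq, dist_eq_norm]
    push_cast
    by_cases hx : x = 0
    · simpa [hx, abs_mul] using hF y
    by_cases hy : y = 0
    · simpa [hy, abs_mul] using hF x
    -- The constant `4 * K` is `2 * K` from the change of radius (the sup bound on `g`) plus `2 * K`
    -- from the change of direction (this estimate).
    have h1 : ‖y‖ * ‖(d x : E) - d y‖ ≤ 2 * ‖x - y‖ := by
      calc ‖y‖ * ‖(d x : E) - d y‖ = ‖‖y‖ • (d x : E) - y‖ := by
            have h : ‖y‖ • (d x : E) - y = ‖y‖ • ((d x : E) - d y) := by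
              rw [smul_sub, ← hd y hy]
            rw [h, norm_smul, norm_norm]
        _ = ‖(‖y‖ - ‖x‖) • (d x : E) + (x - y)‖ := by
            rw [sub_smul, ← hd x hx]
            congr 1
            abel
        _ ≤ |‖y‖ - ‖x‖| + ‖x - y‖ := by
            refine (norm_add_le _ _).trans_eq ?_
            rw [norm_smul, norm_eq_of_mem_sphere, mul_one, Real.norm_eq_abs]
        _ ≤ 2 * ‖x - y‖ := by
            have := abs_norm_sub_norm_le y x
            rw [norm_sub_rev] at this
            linarith
    have h2 : |‖x‖ - ‖y‖| ≤ ‖x - y‖ := abs_norm_sub_norm_le x y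
    have h3 : |g (d x) - g (d y)| ≤ K * ‖(d x : E) - d y‖ := by
      have := hg.dist_le_mul (d x) (d y)
      rwa [Real.dist_eq, Subtype.dist_eq, dist_eq_norm] at this
    calc |‖x‖ * g (d x) - ‖y‖ * g (d y)|
        = |(‖x‖ - ‖y‖) * g (d x) + ‖y‖ * (g (d x) - g (d y))| := by ring_nf
      _ ≤ |‖x‖ - ‖y‖| * |g (d x)| + ‖y‖ * |g (d x) - g (d y)| := by
          refine (abs_add_le _ _).trans_eq ?_
          rw [abs_mul, abs_mul, abs_norm]
      _ ≤ ‖x - y‖ * (2 * K) + ‖y‖ * (K * ‖(d x : E) - d y‖) := by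
          gcongr
          exact hb _
      _ = ‖x - y‖ * (2 * K) + K * (‖y‖ * ‖(d x : E) - d y‖) := by ring
      _ ≤ ‖x - y‖ * (2 * K) + K * (2 * ‖x - y‖) := by gcongr
      _ = 4 * K * ‖x - y‖ := by ring
  · have hne : r • (u : E) ≠ 0 := smul_ne_zero hr.ne' (ne_zero_of_mem_unit_sphere u)
    have hn : ‖r • (u : E)‖ = r := by
      rw [norm_smul, norm_eq_of_mem_sphere, mul_one, Real.norm_of_nonneg hr.le]
    have h := hd _ hne
    rw [hn] at h
    have : d (r • (u : E)) = u := Subtype.ext (smul_right_injective E hr.ne' h.symm)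
    simp only [hn, this]

open ProbabilityTheory in
theorem LipschitzWith.lintegral_exp_uniformSphere_le {n : ℕ} {g : USphere n → ℝ} {K : ℝ≥0}
    (hg : LipschitzWith K g) (h0 : ∫ u, g u ∂(uniformSphere n) = 0) :
    ∫⁻ u, ENNReal.ofReal (Real.exp
        ((∫ x, ‖x‖ ∂(stdGaussian (EuclideanSpace ℝ (Fin (n + 1))))) * g u)) ∂(uniformSphere n) ≤
      ENNReal.ofReal (Real.exp (2 * Real.pi ^ 2 * K ^ 2)) := by
  let E := EuclideanSpace ℝ (Fin (n + 1))
  obtain ⟨F, hFL, hF⟩ := hg.exists_homogeneous_extension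
    (hg.abs_le_of_integral_uniformSphere_eq_zero h0)
  obtain ⟨ρ, hρ, hpolar⟩ := exists_stdGaussian_eq_map_uniformSphere_prod n
  set γ := stdGaussian (EuclideanSpace ℝ (Fin (n + 1)))
  have hmeas : Measurable fun p : USphere n × Set.Ioi (0 : ℝ) => (p.2 : ℝ) • (p.1 : E) := by
    fun_prop
  have hFint : Integrable F γ := by
    refine ((IsGaussian.integrable_id.norm.const_mul ((4 * K : ℝ≥0) : ℝ)).add
      (integrable_const |F 0|)).mono' hFL.continuous.aestronglyMeasurable (.of_forall fun x => ?_)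
    have h1 := hFL.dist_le_mul x 0
    rw [Real.dist_eq, dist_zero_right] at h1
    have h2 := abs_add_le (F x - F 0) (F 0)
    rw [sub_add_cancel] at h2
    simp only [Pi.add_apply, id_eq, Real.norm_eq_abs]
    linarith
  have hF0 : ∫ x, F x ∂γ = 0 := by
    rw [hpolar, integral_map hmeas.aemeasurable hFL.continuous.aestronglyMeasurable]
    calc ∫ p, F ((p.2 : ℝ) • (p.1 : E)) ∂((uniformSphere n).prod ρ)
        = ∫ p, g p.1 * (p.2 : ℝ) ∂((uniformSphere n).prod ρ) :=
          integral_congr_ae (.of_forall fun p => by simp only [hF p.1 p.2 p.2.2, mul_comm])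
      _ = 0 := by
          rw [integral_prod_mul g (fun r : Set.Ioi (0 : ℝ) => (r : ℝ)), h0, zero_mul]
  have hnorm : ∀ p : USphere n × Set.Ioi (0 : ℝ), ‖(p.2 : ℝ) • (p.1 : E)‖ = p.2 := fun p => by
    rw [norm_smul, norm_eq_of_mem_sphere, mul_one, Real.norm_of_nonneg (le_of_lt p.2.2)]
  have hmean : ∫ x, ‖x‖ ∂γ = ∫ r : Set.Ioi (0 : ℝ), (r : ℝ) ∂ρ := by
    rw [hpolar, integral_map hmeas.aemeasurable continuous_norm.aestronglyMeasurable]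
    simp only [hnorm]
    rw [integral_fun_snd (μ := uniformSphere n) (fun r : Set.Ioi (0 : ℝ) => (r : ℝ))]
    simp
  have hrint : Integrable (fun r : Set.Ioi (0 : ℝ) => (r : ℝ)) ρ := by
    have h1 : Integrable (fun x : E => ‖x‖) γ := IsGaussian.integrable_id.norm
    rw [hpolar, integrable_map_measure continuous_norm.aestronglyMeasurable hmeas.aemeasurable]
      at h1
    simp only [Function.comp_def, hnorm] at h1
    exact (Integrable.comp_snd_iff (μ := uniformSphere n)
      (f := fun r : Set.Ioi (0 : ℝ) => (r : ℝ)) (IsProbabilityMeasure.ne_zero _)).1 h1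
  have hFm : Measurable fun x : E => ENNReal.ofReal (Real.exp (F x)) :=
    (Real.continuous_exp.comp hFL.continuous).measurable.ennreal_ofReal
  have hFm' : Measurable fun p : USphere n × Set.Ioi (0 : ℝ) =>
      ENNReal.ofReal (Real.exp (F ((p.2 : ℝ) • (p.1 : E)))) := hFm.comp hmeas
  have hFm2 : Measurable fun p : E × E => ENNReal.ofReal (Real.exp (F p.2 - F p.1)) :=
    (Real.continuous_exp.comp ((hFL.continuous.comp continuous_snd).sub
      (hFL.continuous.comp continuous_fst))).measurable.ennreal_ofReal
  calc ∫⁻ u, ENNReal.ofReal (Real.exp ((∫ x, ‖x‖ ∂γ) * g u)) ∂(uniformSphere n)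
      ≤ ∫⁻ u, ∫⁻ r : Set.Ioi (0 : ℝ), ENNReal.ofReal (Real.exp (F ((r : ℝ) • (u : E)))) ∂ρ
          ∂(uniformSphere n) := by
        refine lintegral_mono fun u => ?_
        rw [hmean, ← integral_mul_const]
        refine (ofReal_exp_integral_le_lintegral (hrint.mul_const _)).trans_eq ?_
        exact lintegral_congr fun r => by rw [hF u r r.2]
    _ = ∫⁻ y, ENNReal.ofReal (Real.exp (F y)) ∂γ := by
        rw [hpolar, lintegral_map hFm hmeas, lintegral_prod _ hFm'.aemeasurable]
    -- Symmetrization: as `F` has Gaussian mean zero, Jensen in an independent copy `y` bounds `exp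
    -- (F x)` by the mean of `exp (F x - F y)`.
    _ ≤ ∫⁻ y, ∫⁻ x, ENNReal.ofReal (Real.exp (F x - F y)) ∂γ ∂γ := by
        rw [lintegral_lintegral_swap]
        · refine lintegral_mono fun x => ?_
          refine le_of_eq_of_le ?_
            (ofReal_exp_integral_le_lintegral ((integrable_const (F x)).sub hFint))
          have : ∫ y, (F x - F y) ∂γ = F x := by
            rw [integral_sub (integrable_const _) hFint, hF0]
            simp
          exact congrArg (fun t => ENNReal.ofReal (Real.exp t)) this.symm
        · exact hFm2.aemeasurable
    _ = ∫⁻ p, ENNReal.ofReal (Real.exp (F p.2 - F p.1)) ∂(γ.prod γ) := by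
        rw [lintegral_prod _ hFm2.aemeasurable]
    _ ≤ _ := by
        -- Here `π² / 8 * (4K)² = 2 π² K²`.
        refine hFL.lintegral_exp_sub_stdGaussian_le.trans_eq ?_
        congr 2
        push_cast
        ring

/-- One-sided deviation estimate on the sphere. -/
theorem LipschitzWith.measureReal_uniformSphere_ge_le {n : ℕ} {g : USphere n → ℝ} {η : ℝ≥0}
    (hη : 0 < η) (hg : LipschitzWith η g) (h0 : ∫ u, g u ∂(uniformSphere n) = 0)
    {ε : ℝ} (hε : 0 < ε) :
    (uniformSphere n).real {u | ε ≤ g u} ≤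
      Real.exp (-(2 * levyConst * ((n : ℝ) + 1) / (η : ℝ) ^ 2 * ε ^ 2)) := by
  have hη' : (0 : ℝ) < η := hη
  have hm := sqrt_le_integral_norm_stdGaussian n
  set m := ∫ x, ‖x‖ ∂(ProbabilityTheory.stdGaussian (EuclideanSpace ℝ (Fin (n + 1))))
  have hm2 : (n + 1) * (2 / Real.pi) ≤ m ^ 2 := by
    have := pow_le_pow_left₀ (by positivity) hm 2
    rwa [mul_pow, Real.sq_sqrt (by positivity), Real.sq_sqrt (by positivity)] at this
  have hm0 : 0 < m := lt_of_lt_of_le (by positivity) hm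
  -- This `t` minimizes the Chernoff exponent `2 π² t² η² - m t ε`.
  let t : ℝ≥0 := ⟨m * ε / (4 * Real.pi ^ 2 * η ^ 2), by positivity⟩
  have ht : (t : ℝ) = m * ε / (4 * Real.pi ^ 2 * η ^ 2) := rfl
  have ht0 : (0 : ℝ) < t := by rw [ht]; positivity
  have hL : LipschitzWith (t * η) fun u => (t : ℝ) * g u := by
    refine LipschitzWith.of_dist_le_mul fun u v => ?_
    rw [Real.dist_eq, ← mul_sub, abs_mul, abs_of_pos ht0, NNReal.coe_mul, mul_assoc]
    exact mul_le_mul_of_nonneg_left (hg.dist_le_mul u v) ht0.le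
  have hmgf := hL.lintegral_exp_uniformSphere_le (by rw [integral_const_mul, h0, mul_zero])
  have hmarkov := mul_meas_ge_le_lintegral₀ (μ := uniformSphere n)
    (f := fun u => ENNReal.ofReal (Real.exp (m * (t * g u))))
    (Real.continuous_exp.comp
      (continuous_const.mul hL.continuous)).measurable.ennreal_ofReal.aemeasurable
    (ENNReal.ofReal (Real.exp (m * (t * ε))))
  have hsub : {u | ε ≤ g u} ⊆ {u | ENNReal.ofReal (Real.exp (m * (t * ε))) ≤
      ENNReal.ofReal (Real.exp (m * (t * g u)))} := fun u hu => by
    have : ε ≤ g u := hu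
    refine ENNReal.ofReal_le_ofReal (Real.exp_le_exp.2 ?_)
    gcongr
  have hchain : ENNReal.ofReal (Real.exp (m * (t * ε))) * uniformSphere n {u | ε ≤ g u} ≤
      ENNReal.ofReal (Real.exp (2 * Real.pi ^ 2 * (t * η : ℝ≥0) ^ 2)) :=
    (mul_le_mul_right (measure_mono hsub) _).trans (hmarkov.trans hmgf)
  have hreal := ENNReal.toReal_mono ENNReal.ofReal_ne_top hchain
  rw [ENNReal.toReal_mul, ENNReal.toReal_ofReal (Real.exp_pos _).le,
    ENNReal.toReal_ofReal (Real.exp_pos _).le] at hreal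
  have hbound : (uniformSphere n).real {u | ε ≤ g u} ≤
      Real.exp (2 * Real.pi ^ 2 * (t * η : ℝ≥0) ^ 2 - m * (t * ε)) := by
    rw [Real.exp_sub, le_div_iff₀ (Real.exp_pos _), mul_comm]
    exact hreal
  refine hbound.trans (Real.exp_le_exp.2 ?_)
  have hpi := Real.pi_pos
  have hval : 2 * Real.pi ^ 2 * (t * η : ℝ≥0) ^ 2 - m * (t * ε) =
      -(m ^ 2 * (ε ^ 2 / (8 * Real.pi ^ 2 * η ^ 2))) := by
    rw [NNReal.coe_mul, ht]
    field_simp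
    ring
  rw [hval, neg_le_neg_iff]
  calc 2 * levyConst * ((n : ℝ) + 1) / (η : ℝ) ^ 2 * ε ^ 2
      = (n + 1) * ε ^ 2 / (9 * Real.pi ^ 3 * η ^ 2) := by
        rw [levyConst]
        field_simp
        norm_num
    -- The argument yields 4 where `levyConst` asks only for 9.
    _ ≤ (n + 1) * ε ^ 2 / (4 * Real.pi ^ 3 * η ^ 2) := by
        gcongr
        norm_num
    _ = (n + 1) * (2 / Real.pi) * (ε ^ 2 / (8 * Real.pi ^ 2 * η ^ 2)) := by
        field_simp
        norm_num
    _ ≤ _ := by gcongr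

theorem lemma1 (n : ℕ) (f : USphere n → ℝ) (η : ℝ≥0) (hη : 0 < η) (hf : LipschitzWith η f)
    (ε : ℝ) (hε : 0 < ε) :
    (uniformSphere n).real {φ : USphere n | ε ≤ |f φ - ∫ θ, f θ ∂(uniformSphere n)|} ≤
      2 * Real.exp (-(2 * levyConst * ((n : ℝ) + 1) / (η : ℝ) ^ 2 * ε ^ 2)) := by
  have hi : Integrable f (uniformSphere n) :=
    hf.continuous.integrable_of_hasCompactSupport (.of_compactSpace _)
  set a := ∫ θ, f θ ∂(uniformSphere n) with ha
  have hL1 : LipschitzWith η fun u => f u - a :=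
    LipschitzWith.of_dist_le_mul fun u v => by simpa using hf.dist_le_mul u v
  have hL2 : LipschitzWith η fun u => a - f u :=
    LipschitzWith.of_dist_le_mul fun u v => by simpa only [dist_sub_left] using hf.dist_le_mul u v
  have h1 := hL1.measureReal_uniformSphere_ge_le hη
    (by rw [integral_sub hi (integrable_const _)]; simp [ha]) hε
  have h2 := hL2.measureReal_uniformSphere_ge_le hη
    (by rw [integral_sub (integrable_const _) hi]; simp [ha]) hε
  have hsub : {φ : USphere n | ε ≤ |f φ - a|} ⊆ {u | ε ≤ f u - a} ∪ {u | ε ≤ a - f u} := by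
    intro u hu
    rcases le_abs.1 (show ε ≤ |f u - a| from hu) with h | h
    · exact Or.inl h
    · exact Or.inr (by simpa using h)
  calc (uniformSphere n).real {φ : USphere n | ε ≤ |f φ - a|}
      ≤ (uniformSphere n).real ({u | ε ≤ f u - a} ∪ {u | ε ≤ a - f u}) := measureReal_mono hsub
    _ ≤ _ := measureReal_union_le _ _
    _ ≤ _ := by rw [two_mul]; exact add_le_add h1 h2
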